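/- Let $s_1=1,\ s_2=2,\ s_3=3,\ s_4=4,\ s_5=6,\ s_6=8,\dots$ be the increasing enumeration of all positive integers of the form $2^a3^b$ with integers $a,b\ge 0$. For real $x$ let $\|x\|$ denote the distance from $x$ to the nearest integer. Then the set $$\Bigl\{\alpha\in[0,1]\;:\;\text{there is } \varkappa>0 \text{ such that } \|s_n\alpha\|>\frac{\varkappa}{\sqrt n\,\log(n+1)}\ \text{ for all integers } n\ge 1\Bigr\}$$ has Hausdorff dimension equal to $1$. -/

import Mathlib

/-- The distance `‖x‖` from a real number `x` to the nearest integer. -/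
noncomputable def distNearestInt (x : ℝ) : ℝ := |x - round x|

/-- The natural numbers of the form `2 ^ a * 3 ^ b` with `a, b ≥ 0`. -/
def IsTwoThreeNumber (m : ℕ) : Prop := ∃ a b : ℕ, m = 2 ^ a * 3 ^ b

/-- The `n`-th term, for `n ≥ 1`, of the increasing enumeration
`s 1 = 1, s 2 = 2, s 3 = 3, s 4 = 4, s 5 = 6, s 6 = 8, …` of the numbers `2 ^ a * 3 ^ b`.
(`Nat.nth` counts from `0`; the value at `n = 0` is not used.) -/
noncomputable def furstenbergSeq (n : ℕ) : ℕ := Nat.nth IsTwoThreeNumber (n - 1)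

open MeasureTheory Measure Set Filter Topology
open scoped ENNReal NNReal

/-! The argument is a Peres–Schlag removal scheme. At most `N + 1` numbers `2 ^ a * 3 ^ b` lie in
`[2 ^ N, 2 ^ (N + 1))`, and each forbids a proportion of order `2 ^ (-k)` of the line, where `2 ^ k`
has order `2 ^ L * N * log N`. The relative loss at level `N` should thus be a small multiple of `1
/ log N`. To measure it against the survivors, equidistribution is applied inside surviving cells of
order at most `N`, which come from only `O(log N)` levels earlier (`card_survivors_succ`). Over so
few levels the density at most halves, so the loss is as expected and the density stays above `β ^
N` (`pow_le_of_density_recursion`).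

For the dimension, a set of zero `t`-dimensional measure would be covered by at most `ε * 2 ^ (t *
N)` balls of radius `2 ^ (-N)`, over all `N`. With `2 * β ^ 2 = 2 ^ t`, deleting these balls as well
costs a proportion `O(ε * β ^ (2 * N))`, negligible against `β ^ N`. By compactness a point of
`wellSpaced L` escapes the cover. Since a term at least `2 ^ N` has index `n` at least of order `N ^
2`, the thresholds take the form `√n * log (n + 1)`. -/

/-! ### Dyadic cells and survivors -/

/-- The indices at depth `e` below the cells indexed by `X`. -/
def dyadicDescendants (X : Finset ℕ) (e : ℕ) : Finset ℕ :=
  X.biUnion fun i => Finset.Ico (i * 2 ^ e) ((i + 1) * 2 ^ e)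

theorem mem_Ico_dyadic_iff {i j e : ℕ} :
    j ∈ Finset.Ico (i * 2 ^ e) ((i + 1) * 2 ^ e) ↔ j / 2 ^ e = i := by
  rw [Finset.mem_Ico, Nat.div_eq_iff (by positivity)]
  have : 0 < 2 ^ e := by positivity
  rw [add_mul, one_mul]
  omega

theorem mem_dyadicDescendants {X : Finset ℕ} {e j : ℕ} :
    j ∈ dyadicDescendants X e ↔ j / 2 ^ e ∈ X := by
  simp only [dyadicDescendants, Finset.mem_biUnion, mem_Ico_dyadic_iff]
  constructor
  · rintro ⟨i, hi, rfl⟩; exact hi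
  · intro h; exact ⟨_, h, rfl⟩

theorem card_dyadicDescendants (X : Finset ℕ) (e : ℕ) :
    (dyadicDescendants X e).card = X.card * 2 ^ e := by
  rw [dyadicDescendants, Finset.card_biUnion]
  · simp only [Nat.card_Ico, add_mul, one_mul, Nat.add_sub_cancel_left]
    simp
  · intro i _ i' _ hne
    rw [Function.onFun, Finset.disjoint_left]
    intro j hj hj'
    rw [mem_Ico_dyadic_iff] at hj hj'
    exact hne (hj.symm.trans hj')

/-- The cells of order `P N` which survive the removal of the bad cells `B 0, …, B (N - 1)`. -/
noncomputable def survivors (P : ℕ → ℕ) (B : ℕ → Set ℕ) : ℕ → Finset ℕ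
  | 0 => {0}
  | N + 1 => by
      classical
      exact (dyadicDescendants (survivors P B N) (P (N + 1) - P N)).filter (· ∉ B N)

theorem mem_survivors_succ {P : ℕ → ℕ} {B : ℕ → Set ℕ} {N j : ℕ} :
    j ∈ survivors P B (N + 1) ↔ j / 2 ^ (P (N + 1) - P N) ∈ survivors P B N ∧ j ∉ B N := by
  simp [survivors, mem_dyadicDescendants]

theorem ancestor_mem_survivors {P : ℕ → ℕ} (hP : Monotone P) {B : ℕ → Set ℕ} {q N : ℕ}
    (hq : q ≤ N) {j : ℕ} (hj : j ∈ survivors P B N) :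
    j / 2 ^ (P N - P q) ∈ survivors P B q := by
  induction N, hq using Nat.le_induction generalizing j with
  | base => simpa using hj
  | succ N hN ih =>
    have := ih (mem_survivors_succ.1 hj).1
    rw [Nat.div_div_eq_div_mul, ← pow_add] at this
    have h1 := hP hN
    have h2 := hP (Nat.le_add_right N 1)
    rwa [show P (N + 1) - P N + (P N - P q) = P (N + 1) - P q by omega] at this

theorem card_le_of_sub_le {X : Finset ℕ} {D : ℕ} (h : ∀ i ∈ X, ∀ j ∈ X, j ≤ i + D) :
    X.card ≤ D + 1 := by
  rcases X.eq_empty_or_nonempty with rfl | hX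
  · simp
  · have : X ⊆ Finset.Icc (X.min' hX) (X.min' hX + D) := by
      intro j hj
      rw [Finset.mem_Icc]
      exact ⟨X.min'_le j hj, h _ (X.min'_mem hX) _ hj⟩
    refine (Finset.card_le_card this).trans ?_
    rw [Nat.card_Icc]; omega

/-! ### Counting cells near rationals -/

/-- In a block of order `l ≤ N`, few multiples of `m / 2 ^ M` are close to an integer. -/
theorem card_block_filter_le {m N l e M i : ℕ} (h1 : 2 ^ N ≤ m) (h2 : m < 2 ^ (N + 1))
    (hl : l ≤ N) (hM : M = l + e) :
    ((Finset.Ico (i * 2 ^ e) ((i + 1) * 2 ^ e)).filter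
      fun j => (m * j + 3 * 2 ^ N) % 2 ^ M ≤ 6 * 2 ^ N).card ≤ 21 * 2 ^ (N - l) := by
  set q0 := (m * (i * 2 ^ e) + 3 * 2 ^ N) / 2 ^ M with hq0
  have hMpos : 0 < 2 ^ M := by positivity
  have hNpos : 0 < 2 ^ (N - l) := by positivity
  have hsub : ((Finset.Ico (i * 2 ^ e) ((i + 1) * 2 ^ e)).filter
      fun j => (m * j + 3 * 2 ^ N) % 2 ^ M ≤ 6 * 2 ^ N) ⊆
      (Finset.Icc q0 (q0 + 2 * 2 ^ (N - l))).biUnion fun q =>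
        (Finset.Ico (i * 2 ^ e) ((i + 1) * 2 ^ e)).filter fun j =>
          (m * j + 3 * 2 ^ N) / 2 ^ M = q ∧ (m * j + 3 * 2 ^ N) % 2 ^ M ≤ 6 * 2 ^ N := by
    intro j hj
    rw [Finset.mem_filter] at hj
    obtain ⟨hj, hb⟩ := hj
    simp only [Finset.mem_biUnion, Finset.mem_filter]
    refine ⟨_, ?_, hj, rfl, hb⟩
    rw [Finset.mem_Ico] at hj
    rw [Finset.mem_Icc]
    constructor
    · exact Nat.div_le_div_right (by gcongr; exact hj.1)
    · have : m * j + 3 * 2 ^ N ≤ (m * (i * 2 ^ e) + 3 * 2 ^ N) + (2 * 2 ^ (N - l)) * 2 ^ M := by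
        have e1 : 2 * 2 ^ (N - l) * 2 ^ M = 2 ^ (N + 1) * 2 ^ e := by
          rw [hM, pow_add, pow_succ]
          have : 2 ^ N = 2 ^ (N - l) * 2 ^ l := by rw [← pow_add]; congr 1; omega
          rw [this]; ring
        rw [e1]
        calc m * j + 3 * 2 ^ N ≤ m * ((i + 1) * 2 ^ e) + 3 * 2 ^ N := by gcongr; exact hj.2.le
          _ = m * (i * 2 ^ e) + 3 * 2 ^ N + m * 2 ^ e := by ring
          _ ≤ _ := by gcongr
      refine (Nat.div_le_div_right this).trans ?_
      rw [Nat.add_mul_div_right _ _ hMpos]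
  refine (Finset.card_le_card hsub).trans ?_
  -- At most `3 * 2 ^ (N - l)` quotients occur. For each, `m * j` runs through a window of length `6
  -- * 2 ^ N` in steps of `m ≥ 2 ^ N`, which allows 7 values of `j`.
  refine (Finset.card_biUnion_le_card_mul _ _ 7 ?_).trans ?_
  · intro q _
    refine card_le_of_sub_le (D := 6) ?_
    intro j hj j' hj'
    rw [Finset.mem_filter] at hj hj'
    by_contra! hlt
    have a1 := Nat.div_add_mod (m * j + 3 * 2 ^ N) (2 ^ M)
    have a2 := Nat.div_add_mod (m * j' + 3 * 2 ^ N) (2 ^ M)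
    rw [hj.2.1] at a1
    rw [hj'.2.1] at a2
    have a3 : m * (j + 7) ≤ m * j' := Nat.mul_le_mul_left _ (by omega)
    have hb := hj'.2.2
    rw [mul_add] at a3
    have : 0 < 2 ^ N := by positivity
    omega
  · rw [Nat.card_Icc]
    omega

/-- The numbers `2 ^ a * 3 ^ b` in `[2 ^ N, 2 ^ (N + 1))`. -/
def twoThreeLevel (N : ℕ) : Finset ℕ :=
  ((Finset.range (N + 1)).image fun b => 2 ^ (N - Nat.log 2 (3 ^ b)) * 3 ^ b).filter
    fun m => 2 ^ N ≤ m ∧ m < 2 ^ (N + 1)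

/-- Each `b` allows at most one `a`, as a dyadic interval contains one term of a sequence that
doubles. The filter discards values spoiled by truncated subtraction. -/
theorem card_twoThreeLevel_le (N : ℕ) : (twoThreeLevel N).card ≤ N + 1 :=
  (Finset.card_filter_le _ _).trans (Finset.card_image_le.trans (by simp))

theorem IsTwoThreeNumber.mem_twoThreeLevel {m N : ℕ} (hm : IsTwoThreeNumber m)
    (h1 : 2 ^ N ≤ m) (h2 : m < 2 ^ (N + 1)) : m ∈ twoThreeLevel N := by
  obtain ⟨a, b, rfl⟩ := hm
  rw [twoThreeLevel, Finset.mem_filter, Finset.mem_image]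
  refine ⟨⟨b, ?_, ?_⟩, h1, h2⟩
  · rw [Finset.mem_range]
    have : 2 ^ b < 2 ^ (N + 1) := by
      calc 2 ^ b ≤ 3 ^ b := Nat.pow_le_pow_left (by norm_num) b
        _ ≤ 2 ^ a * 3 ^ b := Nat.le_mul_of_pos_left _ (by positivity)
        _ < _ := h2
    exact (Nat.pow_lt_pow_iff_right (by norm_num)).1 this
  · have h3 : 2 ^ Nat.log 2 (3 ^ b) ≤ 3 ^ b := Nat.pow_log_le_self 2 (by positivity)
    have h4 : 3 ^ b < 2 ^ (Nat.log 2 (3 ^ b) + 1) := Nat.lt_pow_succ_log_self (by norm_num) _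
    have h5 : 2 ^ (a + Nat.log 2 (3 ^ b)) < 2 ^ (N + 1) := by
      rw [pow_add]; exact (Nat.mul_le_mul_left _ h3).trans_lt h2
    have h6 : 2 ^ N < 2 ^ (a + (Nat.log 2 (3 ^ b) + 1)) := by
      rw [pow_add]; exact h1.trans_lt (Nat.mul_lt_mul_of_pos_left h4 (by positivity))
    rw [Nat.pow_lt_pow_iff_right (by norm_num)] at h5 h6
    congr 2
    omega

/-! ### Thresholds and losses -/

/-- One more than the binary logarithm of `N + 1`. -/
def levelLog (N : ℕ) : ℕ := Nat.log 2 (N + 1) + 1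

/-- The exponent of the threshold `2 ^ (-levelExp L N)` used for multipliers in
`[2 ^ N, 2 ^ (N + 1))`; it exceeds `log₂ (N log N)` by about `L`. -/
def levelExp (L N : ℕ) : ℕ := L + levelLog N + (Nat.log 2 (levelLog N) + 1)

/-- The orders of the dyadic cells used in the construction. -/
def cellOrder (L : ℕ) : ℕ → ℕ
  | 0 => 0
  | N + 1 => N + levelExp L N

theorem levelLog_pos (N : ℕ) : 0 < levelLog N := Nat.succ_pos _

theorem levelLog_mono : Monotone levelLog := fun _ _ h =>
  Nat.succ_le_succ (Nat.log_mono_right (by omega))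

theorem levelLog_le (N : ℕ) : levelLog N ≤ N + 1 :=
  Nat.log_lt_of_lt_pow (by omega) (Nat.lt_two_pow_self)

theorem levelExp_mono (L : ℕ) : Monotone (levelExp L) := fun _ _ h => by
  have h1 := levelLog_mono h
  have h2 := Nat.log_mono_right (b := 2) h1
  unfold levelExp
  omega

theorem cellOrder_mono (L : ℕ) : Monotone (cellOrder L) := by
  refine monotone_nat_of_le_succ fun N => ?_
  cases N with
  | zero => exact Nat.zero_le _
  | succ N =>
    have := levelExp_mono L (Nat.le_succ N)
    simp only [cellOrder, Nat.succ_eq_add_one] at *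
    omega

theorem levelExp_le (L N : ℕ) : levelExp L N ≤ L + 2 * levelLog N := by
  have : Nat.log 2 (levelLog N) < levelLog N :=
    Nat.log_lt_of_lt_pow (levelLog_pos N).ne' Nat.lt_two_pow_self
  unfold levelExp
  omega

theorem mul_levelLog_le_two_pow (L N : ℕ) :
    2 ^ L * ((N + 1) * levelLog N) ≤ 2 ^ levelExp L N := by
  have h1 : N + 1 < 2 ^ levelLog N := Nat.lt_pow_succ_log_self (by norm_num) _
  have h2 : levelLog N < 2 ^ (Nat.log 2 (levelLog N) + 1) :=
    Nat.lt_pow_succ_log_self (by norm_num) _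
  rw [levelExp, pow_add, pow_add, mul_assoc]
  gcongr

theorem two_pow_levelExp_le (L N : ℕ) :
    2 ^ levelExp L N ≤ 2 ^ L * (4 * ((N + 1) * levelLog N)) := by
  have h1 : 2 ^ Nat.log 2 (N + 1) ≤ N + 1 := Nat.pow_log_le_self _ (by omega)
  have h2 : 2 ^ Nat.log 2 (levelLog N) ≤ levelLog N :=
    Nat.pow_log_le_self _ (levelLog_pos N).ne'
  have h3 : 2 ^ levelLog N ≤ 2 * (N + 1) := by
    rw [levelLog, pow_succ]; omega
  rw [levelExp, pow_add, pow_add, pow_succ, mul_assoc]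
  calc 2 ^ L * (2 ^ levelLog N * (2 ^ Nat.log 2 (levelLog N) * 2))
      ≤ 2 ^ L * ((2 * (N + 1)) * (levelLog N * 2)) := by gcongr
    _ = _ := by ring

/-- The relative loss allowed at level `N`. -/
noncomputable def levelLoss (L N : ℕ) : ℝ := 64 * (1 / 2) ^ L / levelLog N

theorem levelLoss_nonneg (L N : ℕ) : 0 ≤ levelLoss L N := by unfold levelLoss; positivity

theorem levelLoss_anti (L : ℕ) : Antitone (levelLoss L) := fun i j h => by
  have h1 : (levelLog i : ℝ) ≤ levelLog j := by exact_mod_cast levelLog_mono h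
  have h2 : (0 : ℝ) < levelLog i := by exact_mod_cast levelLog_pos i
  unfold levelLoss
  gcongr

theorem levelLoss_le (L N : ℕ) : levelLoss L N ≤ 64 * (1 / 2) ^ L := by
  have h2 : (1 : ℝ) ≤ levelLog N := by exact_mod_cast levelLog_pos N
  unfold levelLoss
  exact div_le_self (by positivity) h2

theorem mul_half_pow_levelExp_le (L N : ℕ) :
    64 * ((N + 1) * (1 / 2 : ℝ) ^ levelExp L N) ≤ levelLoss L N := by
  have h2 : (0 : ℝ) < levelLog N := by exact_mod_cast levelLog_pos N
  have h : (2 : ℝ) ^ L * ((N + 1) * levelLog N) ≤ 2 ^ levelExp L N := by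
    exact_mod_cast mul_levelLog_le_two_pow L N
  unfold levelLoss
  rw [mul_div_assoc]
  gcongr
  rw [le_div_iff₀ h2, one_div, inv_pow, inv_pow, ← one_div, ← one_div, mul_one_div,
    div_mul_eq_mul_div, div_le_div_iff₀ (by positivity) (by positivity)]
  linarith

/-! ### The density recursion -/

/-- Bernoulli's inequality for `d` successive losses of proportion `θ`. -/
theorem sub_mul_le_of_ratio {G : ℕ → ℝ} {θ : ℝ} (hG : ∀ N, 0 ≤ G N) (hθ : 0 ≤ θ) {p : ℕ}
    (hθ1 : θ ≤ 1) (d : ℕ) (h : ∀ j, p ≤ j → j < p + d → (1 - θ) * G j ≤ G (j + 1)) :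
    (1 - d * θ) * G p ≤ G (p + d) := by
  induction d with
  | zero => simp
  | succ d ih =>
    have h1 := ih fun j hj hj' => h j hj (by omega)
    have h2 := h (p + d) (by omega) (by omega)
    have h3 := mul_le_mul_of_nonneg_left h1 (sub_nonneg.2 hθ1)
    rw [← add_assoc]
    refine le_trans ?_ (h3.trans h2)
    rw [← mul_assoc]
    refine mul_le_mul_of_nonneg_right ?_ (hG p)
    push_cast
    nlinarith [mul_nonneg (Nat.cast_nonneg (α := ℝ) d) (mul_nonneg hθ hθ)]

/-- A density recursion in which the loss at level `N` is governed by the density at any much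
earlier level has a solution bounded below by a geometric sequence. -/
theorem pow_le_of_density_recursion {L : ℕ} {β : ℝ} (hβ : 0 < β)
    (hL : 64 * (1 / 2 : ℝ) ^ L * (L + 2) ≤ 1 / 2) (hLβ : 64 * (1 / 2 : ℝ) ^ L ≤ 1 - β)
    {G X : ℕ → ℝ} (hG0 : G 0 = 1) (hG : ∀ N, 0 ≤ G N)
    (hX : ∀ N, 8 * X N ≤ levelLoss L N * β ^ N)
    (hrec : ∀ N p, p ≤ N → cellOrder L p ≤ N →
      G N - 21 * ((N + 1) * (1 / 2 : ℝ) ^ levelExp L N) * G p - X N ≤ G (N + 1)) (N : ℕ) :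
    β ^ N ≤ G N := by
  have hloss1 : ∀ N, levelLoss L N ≤ 1 - β := fun N => (levelLoss_le L N).trans hLβ
  suffices H : ∀ N, β ^ N ≤ G N ∧ ∀ j < N, (1 - levelLoss L j) * G j ≤ G (j + 1) from (H N).1
  intro N
  induction N with
  | zero => simp [hG0]
  | succ N ih =>
    obtain ⟨ih1, ih2⟩ := ih
    have key : (1 - levelLoss L N) * G N ≤ G (N + 1) := by
      -- The latest level whose cells are still coarse enough for equidistribution. Maximality keeps
      -- `N - p` logarithmic.
      set p := Nat.findGreatest (fun p => cellOrder L p ≤ N) N with hp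
      have hpN : p ≤ N := Nat.findGreatest_le N
      have hp1 : cellOrder L p ≤ N :=
        Nat.findGreatest_spec (P := fun p => cellOrder L p ≤ N) (m := 0) (Nat.zero_le _)
          (Nat.zero_le _)
      have hwin : N - p ≤ levelExp L p := by
        rcases hpN.eq_or_lt with h | h
        · omega
        · have := Nat.findGreatest_is_greatest (P := fun p => cellOrder L p ≤ N)
            (Nat.lt_succ_self p) h
          simp only [cellOrder] at this
          omega
      obtain ⟨d, hd⟩ := Nat.exists_eq_add_of_le hpN
      have hθ0 := levelLoss_nonneg L p
      have hhalf : (1 - d * levelLoss L p) * G p ≤ G N := by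
        rw [hd]
        refine sub_mul_le_of_ratio hG hθ0 (by linarith [hloss1 p]) d fun j hj hj' => ?_
        refine le_trans ?_ (ih2 j (by omega))
        exact mul_le_mul_of_nonneg_right (by linarith [levelLoss_anti L hj]) (hG j)
      -- The window length is `O(levelLog p)`, which cancels the denominator of the loss.
      have hd2 : (d : ℝ) * levelLoss L p ≤ 1 / 2 := by
        have h1 : (d : ℝ) ≤ (L + 2) * levelLog p := by
          have h1 : d ≤ L + 2 * levelLog p := by have := levelExp_le L p; omega
          have h2 : L ≤ L * levelLog p := Nat.le_mul_of_pos_right _ (levelLog_pos p)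
          have h3 : d ≤ (L + 2) * levelLog p := by rw [add_mul]; omega
          exact_mod_cast h3
        have h2 : (0 : ℝ) < levelLog p := by exact_mod_cast levelLog_pos p
        calc (d : ℝ) * levelLoss L p ≤ ((L + 2) * levelLog p) * levelLoss L p := by gcongr
          _ = 64 * (1 / 2 : ℝ) ^ L * (L + 2) := by unfold levelLoss; field_simp
          _ ≤ _ := hL
      have hGp : G p ≤ 2 * G N := by nlinarith [hG p]
      have h1 := hrec N p hpN hp1
      have h2 := mul_half_pow_levelExp_le L N
      have h3 : levelLoss L N * β ^ N ≤ levelLoss L N * G N :=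
        mul_le_mul_of_nonneg_left ih1 (levelLoss_nonneg L N)
      have h4 := hX N
      have h5 : 0 ≤ ((N : ℝ) + 1) * (1 / 2 : ℝ) ^ levelExp L N := by positivity
      have h6 := mul_le_mul_of_nonneg_left hGp h5
      have h7 := mul_le_mul_of_nonneg_right h2 (hG N)
      have h8 := mul_nonneg (levelLoss_nonneg L N) (hG N)
      -- The multipliers cost `2 * 21 / 64` of the allowed loss and `X N` costs `1 / 8` of it, in
      -- total less than 1.
      nlinarith
    refine ⟨?_, ?_⟩
    · calc β ^ (N + 1) = β * β ^ N := by ring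
        _ ≤ (1 - levelLoss L N) * G N := by
          have := hloss1 N
          gcongr <;> linarith
        _ ≤ _ := key
    · intro j hj
      rcases Nat.lt_succ_iff_lt_or_eq.1 hj with h | rfl
      · exact ih2 j h
      · exact key

/-! ### Counting removed cells -/

/-- The cells removed at level `N`: those near a rational with denominator a number
`2 ^ a * 3 ^ b` of that level, and those near a point of `C N`. -/
def badCells (L : ℕ) (C : ℕ → Finset ℝ) (N : ℕ) : Set ℕ :=
  {j | (∃ m ∈ twoThreeLevel N, (m * j + 3 * 2 ^ N) % 2 ^ (N + levelExp L N) ≤ 6 * 2 ^ N) ∨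
    ∃ c ∈ C N, |(j : ℝ) / 2 ^ (N + levelExp L N) - c| ≤ 2 / 2 ^ N}

theorem card_filter_abs_sub_le (X : Finset ℕ) (N k : ℕ) (c : ℝ)
    [DecidablePred fun j : ℕ => |(j : ℝ) / 2 ^ (N + k) - c| ≤ 2 / 2 ^ N] :
    (X.filter fun j : ℕ => |(j : ℝ) / 2 ^ (N + k) - c| ≤ 2 / 2 ^ N).card ≤ 5 * 2 ^ k := by
  have : 0 < 2 ^ k := by positivity
  refine (card_le_of_sub_le (D := 4 * 2 ^ k) fun i hi j hj => ?_).trans (by omega)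
  rw [Finset.mem_filter] at hi hj
  have h1 := (abs_le.1 hi.2).1
  have h2 := (abs_le.1 hj.2).2
  have h3 : (j : ℝ) / 2 ^ (N + k) - i / 2 ^ (N + k) ≤ 4 / 2 ^ N := by
    have : (4 : ℝ) / 2 ^ N = 2 / 2 ^ N + 2 / 2 ^ N := by ring
    linarith
  rw [← sub_div, div_le_div_iff₀ (by positivity) (by positivity), pow_add] at h3
  have h4 : (j : ℝ) - i ≤ 4 * 2 ^ k := by
    have hN : (0 : ℝ) < 2 ^ N := by positivity
    refine le_of_mul_le_mul_right ?_ hN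
    linarith
  have h5 : (j : ℝ) ≤ ((i + 4 * 2 ^ k : ℕ) : ℝ) := by push_cast; linarith
  exact_mod_cast h5

/-- A cell removed because of `m` lies below its surviving ancestor at level `p`. Counting in these
coarser blocks is what makes `card_block_filter_le` applicable. -/
theorem card_survivors_succ (L : ℕ) (C : ℕ → Finset ℝ) (N p : ℕ) (hpN : p ≤ N)
    (hp : cellOrder L p ≤ N) :
    (survivors (cellOrder L) (badCells L C) N).card * 2 ^ (cellOrder L (N + 1) - cellOrder L N) ≤
      (survivors (cellOrder L) (badCells L C) (N + 1)).card +
      ((N + 1) * ((survivors (cellOrder L) (badCells L C) p).card *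
        (21 * 2 ^ (N - cellOrder L p))) + (C N).card * (5 * 2 ^ levelExp L N)) := by
  classical
  set S := survivors (cellOrder L) (badCells L C) with hS
  set d := cellOrder L (N + 1) - cellOrder L N with hd
  set e := cellOrder L (N + 1) - cellOrder L p with he
  have hM : N + levelExp L N = cellOrder L p + e := by
    have := cellOrder_mono L (show p ≤ N + 1 by omega)
    simp only [he, cellOrder] at this ⊢
    omega
  have hsub : dyadicDescendants (S N) d ⊆ S (N + 1) ∪
      ((twoThreeLevel N).biUnion (fun m => (S p).biUnion fun i =>
        (Finset.Ico (i * 2 ^ e) ((i + 1) * 2 ^ e)).filter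
          fun j => (m * j + 3 * 2 ^ N) % 2 ^ (N + levelExp L N) ≤ 6 * 2 ^ N) ∪
      (C N).biUnion (fun c => (dyadicDescendants (S N) d).filter
        fun j : ℕ => |(j : ℝ) / 2 ^ (N + levelExp L N) - c| ≤ 2 / 2 ^ N)) := by
    intro j hj
    have hj' := mem_dyadicDescendants.1 hj
    by_cases hb : j ∈ badCells L C N
    · rw [Finset.mem_union, Finset.mem_union]
      rcases hb with ⟨m, hm, hmj⟩ | ⟨c, hc, hcj⟩
      · refine Or.inr (Or.inl ?_)
        simp only [Finset.mem_biUnion, Finset.mem_filter]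
        refine ⟨m, hm, j / 2 ^ e, ?_, mem_Ico_dyadic_iff.2 rfl, hmj⟩
        have := ancestor_mem_survivors (cellOrder_mono L) hpN hj'
        rw [Nat.div_div_eq_div_mul, ← pow_add] at this
        have h1 := cellOrder_mono L hpN
        have h2 := cellOrder_mono L (Nat.le_add_right N 1)
        rwa [show d + (cellOrder L N - cellOrder L p) = e by omega] at this
      · refine Or.inr (Or.inr ?_)
        simp only [Finset.mem_biUnion, Finset.mem_filter]
        exact ⟨c, hc, hj, hcj⟩
    · exact Finset.mem_union_left _ (mem_survivors_succ.2 ⟨hj', hb⟩)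
  rw [← card_dyadicDescendants]
  refine (Finset.card_le_card hsub).trans ((Finset.card_union_le _ _).trans ?_)
  gcongr
  refine (Finset.card_union_le _ _).trans ?_
  gcongr
  · refine (Finset.card_biUnion_le_card_mul _ _ ((S p).card * (21 * 2 ^ (N - cellOrder L p)))
      fun m hm => ?_).trans (Nat.mul_le_mul_right _ (card_twoThreeLevel_le N))
    refine Finset.card_biUnion_le_card_mul _ _ _ fun i _ => ?_
    have hm' := (Finset.mem_filter.1 hm).2
    exact card_block_filter_le hm'.1 hm'.2 hp hM
  · refine Finset.card_biUnion_le_card_mul _ _ _ fun c _ => ?_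
    exact card_filter_abs_sub_le _ N (levelExp L N) c

theorem survivors_nonempty {L : ℕ} {β ε : ℝ} (hβ : 0 < β)
    (hL : 64 * (1 / 2 : ℝ) ^ L * (L + 2) ≤ 1 / 2) (hLβ : 64 * (1 / 2 : ℝ) ^ L ≤ 1 - β)
    (hε : ∀ N : ℕ, ε * ((N + 1) * β ^ N) ≤ (1 / 2) ^ L)
    {C : ℕ → Finset ℝ} (hC : ∀ N, ((C N).card : ℝ) ≤ ε * (2 * β ^ 2) ^ N) (N : ℕ) :
    (survivors (cellOrder L) (badCells L C) N).Nonempty := by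
  set S := survivors (cellOrder L) (badCells L C) with hS
  have key := pow_le_of_density_recursion hβ hL hLβ (G := fun N => (S N).card / 2 ^ cellOrder L N)
    (X := fun N => 5 * (C N).card / 2 ^ N) (by simp [hS, survivors, cellOrder])
    (fun N => by positivity) ?_ ?_ N
  · rw [← Finset.card_pos]
    have h1 : (0 : ℝ) < (S N).card / 2 ^ cellOrder L N := lt_of_lt_of_le (by positivity) key
    by_contra! h
    have : (S N).card = 0 := by omega
    simp [this] at h1
  · intro N
    have h1 : (levelLog N : ℝ) ≤ N + 1 := by exact_mod_cast levelLog_le N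
    have h0 : (0 : ℝ) < levelLog N := by exact_mod_cast levelLog_pos N
    have h2 : ((C N).card : ℝ) / 2 ^ N ≤ ε * (β ^ N * β ^ N) := by
      rw [div_le_iff₀ (by positivity)]
      refine (hC N).trans_eq ?_
      rw [mul_pow, ← pow_mul, mul_comm 2 N, pow_mul]
      ring
    have h3 : ((C N).card : ℝ) / 2 ^ N * levelLog N ≤ (1 / 2) ^ L * β ^ N := by
      calc ((C N).card : ℝ) / 2 ^ N * levelLog N
          ≤ ((C N).card : ℝ) / 2 ^ N * (N + 1) := by gcongr
        _ ≤ (ε * (β ^ N * β ^ N)) * (N + 1) := by gcongr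
        _ = (ε * ((N + 1) * β ^ N)) * β ^ N := by ring
        _ ≤ _ := by gcongr; exact hε N
    have h4 : (0 : ℝ) ≤ (1 / 2) ^ L * β ^ N := by positivity
    have h5 : levelLoss L N * β ^ N = 64 * ((1 / 2) ^ L * β ^ N) / levelLog N := by
      unfold levelLoss; ring
    rw [h5, le_div_iff₀ h0]
    calc 8 * (5 * ((C N).card : ℝ) / 2 ^ N) * levelLog N
        = 40 * ((C N).card / 2 ^ N * levelLog N) := by ring
      _ ≤ 64 * ((1 / 2) ^ L * β ^ N) := by linarith
  · intro N p hpN hp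
    have h := card_survivors_succ L C N p hpN hp
    have h' : ((S N).card : ℝ) * 2 ^ (cellOrder L (N + 1) - cellOrder L N) ≤
      (S (N + 1)).card + ((N + 1) * ((S p).card * (21 * 2 ^ (N - cellOrder L p))) +
        (C N).card * (5 * 2 ^ levelExp L N)) := by exact_mod_cast h
    have h2 : (0 : ℝ) < 2 ^ (cellOrder L (N + 1)) := by positivity
    have h3 := div_le_div_of_nonneg_right h' h2.le
    have e1 : ((S N).card : ℝ) * 2 ^ (cellOrder L (N + 1) - cellOrder L N) /
        2 ^ (cellOrder L (N + 1)) = (S N).card / 2 ^ cellOrder L N := by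
      rw [pow_sub₀ _ (by norm_num) (cellOrder_mono L (Nat.le_add_right N 1))]
      field_simp
    have e2 : ((2 : ℝ) ^ (N - cellOrder L p)) = 2 ^ N / 2 ^ cellOrder L p := by
      rw [pow_sub₀ _ (by norm_num) hp]; rfl
    have e3 : ((N : ℝ) + 1) * ((S p).card * (21 * 2 ^ (N - cellOrder L p))) /
        2 ^ (cellOrder L (N + 1)) =
        21 * ((N + 1) * (1 / 2 : ℝ) ^ levelExp L N) * ((S p).card / 2 ^ cellOrder L p) := by
      rw [e2, cellOrder, pow_add, one_div, inv_pow]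
      field_simp
    have e4 : ((C N).card : ℝ) * (5 * 2 ^ levelExp L N) / 2 ^ (cellOrder L (N + 1)) =
        5 * (C N).card / 2 ^ N := by
      rw [cellOrder, pow_add]
      field_simp
    rw [add_div, add_div, e1, e3, e4] at h3
    linarith

/-- If every level has a surviving cell, some point lies in a surviving cell of every level. -/
theorem exists_mem_survivors_cells {P : ℕ → ℕ} (hP : Monotone P) {B : ℕ → Set ℕ}
    (h : ∀ N, (survivors P B N).Nonempty) :
    ∃ x : ℝ, ∀ N, ∃ j ∈ survivors P B N, x ∈ Set.Icc ((j : ℝ) / 2 ^ P N) ((j + 1) / 2 ^ P N) := by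
  let K : ℕ → Set ℝ := fun N =>
    ⋃ j ∈ survivors P B N, Set.Icc ((j : ℝ) / 2 ^ P N) ((j + 1) / 2 ^ P N)
  have hcomp : ∀ N, IsCompact (K N) := fun N =>
    (survivors P B N).finite_toSet.isCompact_biUnion fun _ _ => isCompact_Icc
  have hK : (⋂ N, K N).Nonempty := by
    refine IsCompact.nonempty_iInter_of_sequence_nonempty_isCompact_isClosed K
      (fun N => ?_) (fun N => ?_) (hcomp 0) (fun N => (hcomp N).isClosed)
    · intro x hx
      simp only [K, Set.mem_iUnion, exists_prop] at hx ⊢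
      obtain ⟨j, hj, hx1, hx2⟩ := hx
      refine ⟨_, (mem_survivors_succ.1 hj).1, ?_⟩
      set d := P (N + 1) - P N with hd
      have hPd : P (N + 1) = P N + d := by have := hP (Nat.le_add_right N 1); omega
      have hd0 : (0 : ℝ) < 2 ^ d := by positivity
      have h0 : (0 : ℝ) < 2 ^ P N := by positivity
      have h1 := (Finset.mem_Ico.1 (mem_Ico_dyadic_iff (e := d) (j := j).2 rfl))
      have h2 : ((j / 2 ^ d : ℕ) : ℝ) * 2 ^ d ≤ j := by exact_mod_cast h1.1
      have h3 : (j : ℝ) + 1 ≤ (((j / 2 ^ d : ℕ) : ℝ) + 1) * 2 ^ d := by exact_mod_cast h1.2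
      rw [hPd, pow_add] at hx1 hx2
      constructor
      · refine le_trans ?_ hx1
        rw [div_le_div_iff₀ h0 (by positivity)]
        nlinarith
      · refine hx2.trans ?_
        rw [div_le_div_iff₀ (by positivity) h0]
        nlinarith
    · obtain ⟨j, hj⟩ := h N
      refine ⟨(j : ℝ) / 2 ^ P N, ?_⟩
      simp only [K, Set.mem_iUnion, exists_prop]
      exact ⟨j, hj, le_rfl, by gcongr; linarith⟩
  obtain ⟨x, hx⟩ := hK
  refine ⟨x, fun N => ?_⟩
  have := Set.mem_iInter.1 hx N
  simpa only [K, Set.mem_iUnion, exists_prop] using this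

/-! ### From surviving cells to points -/

/-- The points of `[0, 1]` whose multiples by numbers `2 ^ a * 3 ^ b` stay away from the integers,
with the threshold `2 ^ (-levelExp L N)` for multipliers in `[2 ^ N, 2 ^ (N + 1))`. -/
def wellSpaced (L : ℕ) : Set ℝ :=
  {x | x ∈ Set.Icc (0 : ℝ) 1 ∧ ∀ N m : ℕ, IsTwoThreeNumber m → 2 ^ N ≤ m → m < 2 ^ (N + 1) →
    (1 / 2 : ℝ) ^ levelExp L N < distNearestInt (m * x)}

/-- Moving from `x` to the left end of its cell changes `m * x` by at most `2 * 2 ^ (-k)`, so the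
tolerance grows to `3 * 2 ^ (-k)`. The shift by `3 * 2 ^ N` makes the two-sided condition a single
residue bound. -/
theorem mod_le_of_distNearestInt_le {m N k j : ℕ} {x : ℝ} (hm : m < 2 ^ (N + 1))
    (h1 : (j : ℝ) / 2 ^ (N + k) ≤ x) (h2 : x ≤ (j + 1) / 2 ^ (N + k))
    (hx : distNearestInt (m * x) ≤ (1 / 2 : ℝ) ^ k) :
    (m * j + 3 * 2 ^ N) % 2 ^ (N + k) ≤ 6 * 2 ^ N := by
  set c := round (m * x) with hc
  have hM : (0 : ℝ) < 2 ^ (N + k) := by positivity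
  rw [div_le_iff₀ hM] at h1
  rw [le_div_iff₀ hM] at h2
  obtain ⟨h3, h4⟩ := abs_le.1 hx
  rw [← hc] at h3 h4
  have hm' : (m : ℝ) ≤ 2 * 2 ^ N := by
    have : (m : ℝ) < 2 ^ (N + 1) := by exact_mod_cast hm
    rw [pow_succ] at this; linarith
  have e1 : (1 / 2 : ℝ) ^ k * 2 ^ (N + k) = 2 ^ N := by
    rw [pow_add, one_div, inv_pow]; field_simp
  have h5 := mul_le_mul_of_nonneg_right h3 hM.le
  have h6 := mul_le_mul_of_nonneg_right h4 hM.le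
  rw [neg_mul, e1] at h5
  rw [e1] at h6
  have hm0 : (0 : ℝ) ≤ m := Nat.cast_nonneg _
  have h7 := mul_le_mul_of_nonneg_left h1 hm0
  have h8 := mul_le_mul_of_nonneg_left h2 hm0
  have h9 : (0 : ℝ) < 2 ^ N := by positivity
  have l1 : (c : ℝ) * 2 ^ (N + k) ≤ m * j + 3 * 2 ^ N := by nlinarith
  have l2 : (m : ℝ) * j + 3 * 2 ^ N - c * 2 ^ (N + k) ≤ 6 * 2 ^ N := by nlinarith
  have l1' : c * 2 ^ (N + k) ≤ (m * j + 3 * 2 ^ N : ℤ) := by exact_mod_cast l1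
  have l2' : (m * j + 3 * 2 ^ N : ℤ) - c * 2 ^ (N + k) ≤ 6 * 2 ^ N := by exact_mod_cast l2
  have : ((m * j + 3 * 2 ^ N : ℤ)) % 2 ^ (N + k) ≤ 6 * 2 ^ N := by
    rw [← Int.sub_mul_emod_self_right (a := (m * j + 3 * 2 ^ N : ℤ)) (b := c)]
    refine le_trans ?_ l2'
    have h1 := Int.emod_add_mul_ediv ((m * j + 3 * 2 ^ N : ℤ) - c * 2 ^ (N + k)) (2 ^ (N + k))
    have h2 : 0 ≤ (2 : ℤ) ^ (N + k) * (((m * j + 3 * 2 ^ N : ℤ) - c * 2 ^ (N + k)) / 2 ^ (N + k)) :=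
      mul_nonneg (by positivity) (Int.ediv_nonneg (by linarith) (by positivity))
    linarith
  exact_mod_cast this

theorem exists_mem_wellSpaced {L : ℕ} {β ε : ℝ} (hβ : 0 < β)
    (hL : 64 * (1 / 2 : ℝ) ^ L * (L + 2) ≤ 1 / 2) (hLβ : 64 * (1 / 2 : ℝ) ^ L ≤ 1 - β)
    (hε : ∀ N : ℕ, ε * ((N + 1) * β ^ N) ≤ (1 / 2) ^ L)
    {C : ℕ → Finset ℝ} (hC : ∀ N, ((C N).card : ℝ) ≤ ε * (2 * β ^ 2) ^ N) :
    ∃ x ∈ wellSpaced L, ∀ N, ∀ c ∈ C N, (1 / 2 : ℝ) ^ N < dist x c := by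
  obtain ⟨x, hx⟩ := exists_mem_survivors_cells (cellOrder_mono L)
    (survivors_nonempty hβ hL hLβ hε hC)
  refine ⟨x, ⟨?_, ?_⟩, ?_⟩
  · obtain ⟨j, hj, hxj⟩ := hx 0
    simp only [survivors, Finset.mem_singleton] at hj
    simpa [hj, cellOrder] using hxj
  · intro N m hm h1 h2
    by_contra! h
    obtain ⟨j, hj, hx1, hx2⟩ := hx (N + 1)
    exact (mem_survivors_succ.1 hj).2 (Or.inl ⟨m, hm.mem_twoThreeLevel h1 h2,
      mod_le_of_distNearestInt_le h2 hx1 hx2 h⟩)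
  · intro N c hc
    by_contra! h
    obtain ⟨j, hj, hx1, hx2⟩ := hx (N + 1)
    refine (mem_survivors_succ.1 hj).2 (Or.inr ⟨c, hc, ?_⟩)
    rw [cellOrder] at hx1 hx2
    rw [Real.dist_eq, one_div, inv_pow, ← one_div] at h
    obtain ⟨h3, h4⟩ := abs_le.1 h
    have h5 : (1 : ℝ) / 2 ^ (N + levelExp L N) ≤ 1 / 2 ^ N := by
      gcongr
      · norm_num
      · omega
    have e : (2 : ℝ) / 2 ^ N = 1 / 2 ^ N + 1 / 2 ^ N := by ring
    rw [add_div] at hx2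
    rw [e, abs_le]
    constructor <;> linarith

/-! ### Growth of the sequence -/

theorem infinite_isTwoThreeNumber : {m | IsTwoThreeNumber m}.Infinite :=
  infinite_of_injective_forall_mem (Nat.pow_right_injective le_rfl) fun a => ⟨a, 0, by simp⟩

theorem isTwoThreeNumber_furstenbergSeq (n : ℕ) : IsTwoThreeNumber (furstenbergSeq n) :=
  Nat.nth_mem_of_infinite infinite_isTwoThreeNumber _

theorem two_pow_mul_three_pow_injective :
    Function.Injective fun q : ℕ × ℕ => 2 ^ q.1 * 3 ^ q.2 := by
  rintro ⟨a, b⟩ ⟨c, d⟩ h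
  have h' : 2 ^ a * 3 ^ b = 2 ^ c * 3 ^ d := h
  have h2 := congrArg (padicValNat 2) h'
  have h3 := congrArg (padicValNat 3) h'
  have : Fact (Nat.Prime 3) := ⟨Nat.prime_three⟩
  have e2 : padicValNat 2 3 = 0 := padicValNat.eq_zero_of_not_dvd (by norm_num)
  have e3 : padicValNat 3 2 = 0 := padicValNat.eq_zero_of_not_dvd (by norm_num)
  rw [padicValNat.mul (by positivity) (by positivity),
    padicValNat.mul (by positivity) (by positivity)] at h2 h3
  simp [padicValNat.pow, e2, e3] at h2 h3
  rw [h2, h3]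

/-- The index of a term of size about `2 ^ N` is at least of order `N ^ 2`. -/
theorem sq_le_of_two_pow_le_furstenbergSeq {n N : ℕ} (hn : 1 ≤ n)
    (h : 2 ^ N ≤ furstenbergSeq n) : (N + 1) ^ 2 ≤ 8 * n := by
  classical
  have hc : Nat.count IsTwoThreeNumber (furstenbergSeq n + 1) = n := by
    rw [furstenbergSeq, Nat.count_nth_succ_of_infinite infinite_isTwoThreeNumber]
    omega
  -- Since `3 ≤ 2 ^ 2`, every pair with `a ≤ N / 2` and `b ≤ N / 4` gives a value at most `2 ^ N`.
  have hsub : (Finset.range (N / 2 + 1) ×ˢ Finset.range (N / 4 + 1)).image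
      (fun q : ℕ × ℕ => 2 ^ q.1 * 3 ^ q.2) ⊆
      (Finset.range (furstenbergSeq n + 1)).filter IsTwoThreeNumber := by
    intro m hm
    simp only [Finset.mem_image, Finset.mem_product, Finset.mem_range, Prod.exists] at hm
    obtain ⟨a, b, ⟨ha, hb⟩, rfl⟩ := hm
    rw [Finset.mem_filter, Finset.mem_range]
    refine ⟨Nat.lt_succ_of_le (le_trans ?_ h), a, b, rfl⟩
    calc 2 ^ a * 3 ^ b ≤ 2 ^ a * (2 ^ 2) ^ b := by gcongr; norm_num
      _ = 2 ^ (a + 2 * b) := by rw [← pow_mul, ← pow_add]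
      _ ≤ 2 ^ N := Nat.pow_le_pow_right (by norm_num) (by omega)
  have hcard := Finset.card_le_card hsub
  rw [← Nat.count_eq_card_filter_range, hc,
    Finset.card_image_of_injective _ two_pow_mul_three_pow_injective, Finset.card_product,
    Finset.card_range, Finset.card_range] at hcard
  have h1 : N + 1 ≤ 2 * (N / 2 + 1) := by omega
  have h2 : N + 1 ≤ 4 * (N / 4 + 1) := by omega
  calc (N + 1) ^ 2 = (N + 1) * (N + 1) := sq _
    _ ≤ (2 * (N / 2 + 1)) * (4 * (N / 4 + 1)) := Nat.mul_le_mul h1 h2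
    _ = 8 * ((N / 2 + 1) * (N / 4 + 1)) := by ring
    _ ≤ 8 * n := by gcongr

theorem two_pow_levelExp_le_sqrt_mul_log {L n N : ℕ} (hn : 1 ≤ n) (h : (N + 1) ^ 2 ≤ 8 * n) :
    (2 : ℝ) ^ levelExp L N ≤ 72 * 2 ^ L * (Real.sqrt n * Real.log (n + 1)) := by
  have hn' : (1 : ℝ) ≤ n := by exact_mod_cast hn
  have h' : ((N : ℝ) + 1) ^ 2 ≤ 8 * n := by exact_mod_cast h
  have h1 : (N : ℝ) + 1 ≤ 3 * Real.sqrt n := by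
    refine abs_le_of_sq_le_sq' (a := (N : ℝ) + 1) ?_ (by positivity) |>.2
    rw [mul_pow, Real.sq_sqrt (by positivity)]
    linarith
  have h2 : (2 * ((N : ℝ) + 1)) ≤ (n + 1) ^ 3 := by
    refine abs_le_of_sq_le_sq' (a := 2 * ((N : ℝ) + 1)) ?_ (by positivity) |>.2
    have h5 : (2 : ℝ) ^ 5 ≤ ((n : ℝ) + 1) ^ 5 := by gcongr; linarith
    nlinarith
  have h3 : (2 : ℝ) ^ levelLog N ≤ (n + 1) ^ 3 := by
    refine le_trans ?_ h2
    have : 2 ^ Nat.log 2 (N + 1) ≤ N + 1 := Nat.pow_log_le_self _ (by omega)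
    have : 2 ^ levelLog N ≤ 2 * (N + 1) := by rw [levelLog, pow_succ]; omega
    exact_mod_cast this
  have h4 := Real.log_le_log (by positivity) h3
  rw [Real.log_pow, Real.log_pow] at h4
  have h5 : (levelLog N : ℝ) ≤ 6 * Real.log (n + 1) := by
    have := Real.log_two_gt_d9
    have h0 : (0 : ℝ) ≤ levelLog N := Nat.cast_nonneg _
    push_cast at h4
    nlinarith
  have h6 : (2 : ℝ) ^ levelExp L N ≤ 2 ^ L * (4 * ((N + 1) * levelLog N)) := by
    exact_mod_cast two_pow_levelExp_le L N
  calc (2 : ℝ) ^ levelExp L N ≤ 2 ^ L * (4 * ((N + 1) * levelLog N)) := h6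
    _ ≤ 2 ^ L * (4 * ((3 * Real.sqrt n) * (6 * Real.log (n + 1)))) := by gcongr
    _ = _ := by ring

theorem lt_distNearestInt_of_mem_wellSpaced {L : ℕ} {x : ℝ} (hx : x ∈ wellSpaced L) {n : ℕ}
    (hn : 1 ≤ n) :
    (1 / (72 * 2 ^ L)) / (Real.sqrt n * Real.log ((n : ℝ) + 1)) <
      distNearestInt ((furstenbergSeq n : ℝ) * x) := by
  have hm := isTwoThreeNumber_furstenbergSeq n
  have hm0 : furstenbergSeq n ≠ 0 := by
    obtain ⟨a, b, h⟩ := hm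
    rw [h]; positivity
  have h1 := Nat.pow_log_le_self 2 hm0
  have h2 := Nat.lt_pow_succ_log_self (b := 2) (by norm_num) (furstenbergSeq n)
  refine lt_of_le_of_lt ?_ (hx.2 _ _ hm h1 h2)
  have h3 := two_pow_levelExp_le_sqrt_mul_log (L := L) hn
    (sq_le_of_two_pow_le_furstenbergSeq hn h1)
  rw [div_div, one_div, one_div_pow, one_div]
  exact inv_anti₀ (by positivity) h3

/-! ### Hausdorff measure and conclusion -/

/-- A criterion for positive Hausdorff measure: the set cannot be covered by balls of radii
`2 ^ (-N)` whose number grows at most like `ε * 2 ^ (t * N)`. -/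
theorem hausdorffMeasure_ne_zero_of_forall_balls {X : Type*} [MetricSpace X] [MeasurableSpace X]
    [BorelSpace X] {E : Set X} {t ε : ℝ} (ht : 0 < t) (hε : 0 < ε)
    (h : ∀ C : ℕ → Finset X, (∀ N, ((C N).card : ℝ) ≤ ε * ((2 : ℝ) ^ t) ^ N) →
      ∃ x ∈ E, ∀ N, ∀ c ∈ C N, (1 / 2 : ℝ) ^ N < dist x c) : μH[t] E ≠ 0 := by
  classical
  intro hzero
  have hγ0 : (0 : ℝ) < 2 ^ t := by positivity
  set γ : ℝ := ((2 : ℝ) ^ t)⁻¹ with hγ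
  have hγpos : 0 < γ := inv_pos.2 hγ0
  have hγ1 : γ < 1 := inv_lt_one_of_one_lt₀ (Real.one_lt_rpow (by norm_num) ht)
  have hhalf : ∀ N : ℕ, ((1 / 2 : ℝ) ^ N) ^ t = γ ^ N := fun N => by
    rw [← Real.rpow_natCast, ← Real.rpow_mul (by norm_num), mul_comm, Real.rpow_mul (by norm_num),
      Real.rpow_natCast, one_div, Real.inv_rpow (by norm_num)]
  -- The factor 2 pays for enlarging the radii, and `γ` for rounding them to powers of `1 / 2`.
  set η : ℝ := ε * γ / 2 with hη
  have hηpos : 0 < η := by positivity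
  obtain ⟨n0, hn0⟩ := exists_pow_lt_of_lt_one (mul_pos hηpos (sub_pos.2 hγ1)) hγ1
  obtain ⟨x0, hx0, -⟩ := h (fun _ => ∅) (fun N => by simp; positivity)
  -- a covering with small total size
  rw [hausdorffMeasure_apply] at hzero
  have h1 := (iSup₂_le_iff.1 hzero.le) 1 one_pos
  have h2 := lt_of_le_of_lt h1 (ENNReal.ofReal_pos.2 hηpos)
  simp only [iInf_lt_iff] at h2
  obtain ⟨T, hcov, hdiam, hsum⟩ := h2
  have hne : ∀ i, Metric.ediam (T i) ≠ ∞ := fun i => ((hdiam i).trans_lt ENNReal.one_lt_top).ne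
  set δ : ℕ → ℝ := fun i => (Metric.ediam (T i)).toReal with hδ
  have hδ0 : ∀ i, 0 ≤ δ i := fun i => ENNReal.toReal_nonneg
  have hδ1 : ∀ i, δ i ≤ 1 := fun i => by
    simpa using ENNReal.toReal_mono ENNReal.one_ne_top (hdiam i)
  have hδsum : ∀ F : Finset ℕ, ∑ i ∈ F, δ i ^ t ≤ η := by
    intro F
    have hle : ∀ i, Metric.ediam (T i) ^ t ≤ ⨆ _ : (T i).Nonempty, Metric.ediam (T i) ^ t := by
      intro i
      rcases (T i).eq_empty_or_nonempty with he | hne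
      · simp [he, ENNReal.zero_rpow_of_pos ht]
      · exact le_iSup (fun _ : (T i).Nonempty => Metric.ediam (T i) ^ t) hne
    have h3 : ∑ i ∈ F, Metric.ediam (T i) ^ t ≤ ENNReal.ofReal η :=
      (Finset.sum_le_sum fun i _ => hle i).trans ((ENNReal.sum_le_tsum F).trans hsum.le)
    have h4 := ENNReal.toReal_mono ENNReal.ofReal_ne_top h3
    rw [ENNReal.toReal_ofReal hηpos.le, ENNReal.toReal_sum
      fun i _ => ENNReal.rpow_ne_top_of_nonneg ht.le (hne i)] at h4
    simpa only [← ENNReal.toReal_rpow] using h4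
  -- enlarge the radii, to make them positive
  set e : ℕ → ℝ := fun i => max (δ i) ((1 / 2) ^ (n0 + i)) with he
  have he0 : ∀ i, 0 < e i := fun i => lt_max_of_lt_right (by positivity)
  have he1 : ∀ i, e i ≤ 1 := fun i =>
    max_le (hδ1 i) (pow_le_one₀ (by norm_num) (by norm_num))
  have hesum : ∀ F : Finset ℕ, ∑ i ∈ F, e i ^ t ≤ 2 * η := by
    intro F
    have h3 : ∀ i, e i ^ t ≤ δ i ^ t + γ ^ n0 * γ ^ i := by
      intro i
      rw [← pow_add, ← hhalf]
      rcases max_choice (δ i) ((1 / 2) ^ (n0 + i)) with hm | hm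
      · rw [he]; simp only [hm]
        exact le_add_of_nonneg_right (by positivity)
      · rw [he]; simp only [hm]
        exact le_add_of_nonneg_left (Real.rpow_nonneg (hδ0 i) _)
    have h4 : ∑ i ∈ F, γ ^ i ≤ (1 - γ)⁻¹ := by
      rw [← tsum_geometric_of_lt_one hγpos.le hγ1]
      exact (summable_geometric_of_lt_one hγpos.le hγ1).sum_le_tsum F fun i _ => by positivity
    calc ∑ i ∈ F, e i ^ t ≤ ∑ i ∈ F, (δ i ^ t + γ ^ n0 * γ ^ i) :=
          Finset.sum_le_sum fun i _ => h3 i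
      _ = ∑ i ∈ F, δ i ^ t + γ ^ n0 * ∑ i ∈ F, γ ^ i := by
          rw [Finset.sum_add_distrib, Finset.mul_sum]
      _ ≤ η + (η * (1 - γ)) * (1 - γ)⁻¹ := by
          have : 0 ≤ ∑ i ∈ F, γ ^ i := Finset.sum_nonneg fun i _ => by positivity
          have := hδsum F
          gcongr
      _ = 2 * η := by
          rw [mul_assoc, mul_inv_cancel₀ (sub_pos.2 hγ1).ne']; ring
  choose ν hν1 hν2 using fun i =>
    exists_nat_pow_near_of_lt_one (he0 i) (he1 i) (by norm_num : (0 : ℝ) < 1 / 2) (by norm_num)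
  have hcard : ∀ (N : ℕ) (F : Finset ℕ), (∀ i ∈ F, ν i = N) →
      (F.card : ℝ) ≤ ε * ((2 : ℝ) ^ t) ^ N := by
    intro N F hF
    have h3 : (F.card : ℝ) * γ ^ (N + 1) ≤ 2 * η := by
      refine le_trans ?_ (hesum F)
      rw [← nsmul_eq_mul]
      refine Finset.card_nsmul_le_sum _ _ _ fun i hi => ?_
      rw [← hhalf, ← hF i hi]
      exact Real.rpow_le_rpow (by positivity) (hν1 i).le ht.le
    have h4 : ((2 : ℝ) ^ t) ^ N = (γ ^ N)⁻¹ := by rw [hγ, inv_pow, inv_inv]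
    rw [h4, ← div_eq_mul_inv, le_div_iff₀ (by positivity)]
    rw [hη, pow_succ] at h3
    refine le_of_mul_le_mul_right ?_ hγpos
    linarith
  have hfin : ∀ N, {i | ν i = N}.Finite := by
    intro N
    by_contra hinf
    obtain ⟨F, hF, hFc⟩ := Set.Infinite.exists_subset_card_eq hinf (⌈ε * ((2 : ℝ) ^ t) ^ N⌉₊ + 1)
    have h3 := hcard N F fun i hi => hF hi
    have h4 := Nat.le_ceil (ε * ((2 : ℝ) ^ t) ^ N)
    rw [hFc] at h3
    push_cast at h3
    linarith
  -- Any point of `T i` serves as centre, and `x0` is a dummy for empty pieces.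
  obtain ⟨x, hxE, hx⟩ := h
    (fun N => (hfin N).toFinset.image fun i => if hi : (T i).Nonempty then hi.some else x0)
    (fun N => (Nat.cast_le.2 Finset.card_image_le).trans
      (hcard N _ fun i hi => by simpa using hi))
  obtain ⟨i, hi⟩ := mem_iUnion.1 (hcov hxE)
  have hTi : (T i).Nonempty := ⟨x, hi⟩
  have h3 := hx (ν i) hTi.some
    (Finset.mem_image.2 ⟨i, by simp, by simp only [hTi, dif_pos]⟩)
  have h4 : dist x hTi.some ≤ δ i := by
    rw [dist_edist]
    exact ENNReal.toReal_mono (hne i) (Metric.edist_le_ediam_of_mem hi hTi.some_mem)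
  exact absurd h3 (not_lt.2 (h4.trans ((le_max_left _ _).trans (hν2 i))))

theorem exists_mul_pow_le {β b : ℝ} (hβ : 0 < β) (hβ1 : β < 1) (hb : 0 < b) :
    ∃ ε : ℝ, 0 < ε ∧ ∀ N : ℕ, ε * ((N + 1) * β ^ N) ≤ b := by
  have h1 : Tendsto (fun N : ℕ => (N : ℝ) * β ^ N + β ^ N) atTop (𝓝 (0 + 0)) :=
    (tendsto_self_mul_const_pow_of_lt_one hβ.le hβ1).add
      (tendsto_pow_atTop_nhds_zero_of_lt_one hβ.le hβ1)
  obtain ⟨K, hK⟩ := h1.bddAbove_range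
  have hK' : ∀ N : ℕ, (N : ℝ) * β ^ N + β ^ N ≤ K := fun N => hK ⟨N, rfl⟩
  have hKpos : 0 < K := lt_of_lt_of_le (by norm_num) (hK' 0)
  refine ⟨b / K, by positivity, fun N => ?_⟩
  rw [div_mul_eq_mul_div, div_le_iff₀ hKpos, add_mul, one_mul]
  exact mul_le_mul_of_nonneg_left (hK' N) hb.le

theorem exists_hausdorffMeasure_wellSpaced_ne_zero {t : ℝ} (ht : 0 < t) (ht1 : t < 1) :
    ∃ L, μH[t] (wellSpaced L) ≠ 0 := by
  set β : ℝ := 2 ^ (-((1 - t) / 2)) with hβdef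
  have hβ : 0 < β := by positivity
  have hβ1 : β < 1 := Real.rpow_lt_one_of_one_lt_of_neg (by norm_num) (by linarith)
  have hβ2 : 2 * β ^ 2 = (2 : ℝ) ^ t := by
    rw [hβdef, ← Real.rpow_natCast, ← Real.rpow_mul (by norm_num)]
    nth_rewrite 1 [← Real.rpow_one 2]
    rw [← Real.rpow_add (by norm_num)]
    congr 1
    push_cast
    ring
  have l0 := tendsto_pow_atTop_nhds_zero_of_lt_one (r := (1 / 2 : ℝ)) (by norm_num) (by norm_num)
  have l1 : Tendsto (fun L : ℕ => 64 * (1 / 2 : ℝ) ^ L) atTop (𝓝 (64 * 0)) := l0.const_mul 64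
  have l2 : Tendsto (fun L : ℕ => 64 * ((L : ℝ) * (1 / 2 : ℝ) ^ L + 2 * (1 / 2 : ℝ) ^ L)) atTop
      (𝓝 (64 * (0 + 2 * 0))) :=
    ((tendsto_self_mul_const_pow_of_lt_one (by norm_num) (by norm_num)).add
      (l0.const_mul 2)).const_mul 64
  obtain ⟨L, hL1, hL2⟩ := ((l1.eventually_lt_const (u := 1 - β) (by linarith)).and
    (l2.eventually_lt_const (u := 1 / 2) (by norm_num))).exists
  obtain ⟨ε, hε0, hε⟩ := exists_mul_pow_le hβ hβ1 (b := (1 / 2 : ℝ) ^ L) (by positivity)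
  refine ⟨L, hausdorffMeasure_ne_zero_of_forall_balls ht hε0 fun C hC => ?_⟩
  rw [← hβ2] at hC
  exact exists_mem_wellSpaced hβ (le_of_eq_of_le (by ring) hL2.le) hL1.le hε hC

theorem mainTheorem5 :
    dimH {α : ℝ | α ∈ Set.Icc (0 : ℝ) 1 ∧ ∃ κ : ℝ, 0 < κ ∧ ∀ n : ℕ, 1 ≤ n →
      κ / (Real.sqrt (n : ℝ) * Real.log ((n : ℝ) + 1)) <
        distNearestInt ((furstenbergSeq n : ℝ) * α)} = 1 := by
  refine le_antisymm ((dimH_mono (subset_univ _)).trans_eq Real.dimH_univ) ?_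
  refine le_of_forall_lt_imp_le_of_dense fun r hr => ?_
  obtain ⟨s, hrs, hs1⟩ := exists_between hr
  lift s to ℝ≥0 using (hs1.trans ENNReal.one_lt_top).ne
  have hs0 : 0 < s := by exact_mod_cast hrs.pos
  obtain ⟨L, hL⟩ := exists_hausdorffMeasure_wellSpaced_ne_zero (t := s) (by exact_mod_cast hs0)
    (by exact_mod_cast hs1)
  refine hrs.le.trans ((le_dimH_of_hausdorffMeasure_ne_zero hL).trans (dimH_mono ?_))
  exact fun x hx => ⟨hx.1, 1 / (72 * 2 ^ L), by positivity,
    fun n hn => lt_distNearestInt_of_mem_wellSpaced hx hn⟩
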